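/- **Conventions.** For families $\mathcal M,\mathcal W$ of sets, the game $\mathsf G_1(\mathcal M,\mathcal W)$ is played in rounds $n\in\omega$: One chooses $M_n\in\mathcal M$ and Two responds with $x_n\in M_n$; Two wins iff $\{x_n:n\in\omega\}\in\mathcal W$, otherwise One wins. $\mathrm I\uparrow\mathsf G$ (resp. $\mathrm{II}\uparrow \mathsf G$) means that One (resp. Two) has a winning full-information strategy; $\mathrm I\uparrow_{\mathrm{pre}}\mathsf G$ means that One has a winning strategy depending only on the round number; $\mathrm{II}\uparrow_{\mathrm{mark}}\mathsf G$ means that Two has a winning strategy depending only on the round number and One's most recent move. Write $\mathsf G\equiv\mathsf H$ if each of the four statements $\mathrm{II}\uparrow_{\mathrm{mark}}$, $\mathrm{II}\uparrow$, $\mathrm I\not\uparrow$, $\mathrm I\not\uparrow_{\mathrm{pre}}$ holds for $\mathsf G$ iff it holds for $\mathsf H$. The games $\mathsf G$ and $\mathsf H$ are *dual* if $\mathrm I\uparrow\mathsf G\Leftrightarrow\mathrm{II}\uparrow\mathsf H$, $\mathrm{II}\uparrow\mathsf G\Leftrightarrow\mathrm I\uparrow\mathsf H$, $\mathrm I\uparrow_{\mathrm{pre}}\mathsf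 G\Leftrightarrow\mathrm{II}\uparrow_{\mathrm{mark}}\mathsf H$ and $\mathrm{II}\uparrow_{\mathrm{mark}}\mathsf G\Leftrightarrow\mathrm I\uparrow_{\mathrm{pre}}\mathsf H$. For a family $\mathcal W$ of subsets of a set, $\neg\mathcal W$ is the family of the subsets not in $\mathcal W$. Let $X$ be a non-empty topological space. An *ideal of closed subsets* of $X$ is a family of non-empty closed subsets that is closed under binary unions and contains $\{x\}$ for every $x\in X$. For such an ideal $\mathcal A$: - $X$ is *$\mathcal A$-normal* if for all $A\in\mathcal A$ and open $U\supseteq A$ there is an open $V$ with $A\subseteq V\subseteq\mathrm{cl}(V)\subseteq U$; $X$ is *functionally $\mathcal A$-normal* if for all such $A,U$ there is a continuous $f:X\to\mathbb R$ with $f=0$ on $A$ and $f=1$ on $X\setminus U$. - $\mathcal O_X(\mathcal A)$ is the set of open covers $\mathscr U$ of $X$ with $\emptyset,X\notin\mathscr U$ such that every $A\in\mathcal A$ is contained in some $U\in\mathscr U$. - For a space $Y$, $\mathscr T_Y$ is the set of proper non-empty open subsets, $\mathscr N_{Y,y}=\{U\in\mathscr T_Y:y\in U\}$, $\mathscr N_Y(A)=\{U\in\mathscr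 T_Y:A\subseteq U\}$, $\mathscr N_Y[\mathcal A]=\{\mathscr N_Y(A):A\in\mathcal A\}$, $\mathscr D_Y$ is the set of dense subsets, and $\Omega_{Y,y}$ is the set of $S\subseteq Y$ with $y\in\mathrm{cl}(S)$. - $MU(X)$ is the set of minimal usco maps from $X$ to $\mathbb R$: maps $\Phi$ from $X$ to the non-empty compact subsets of $\mathbb R$ such that $\{x:\Phi(x)\subseteq V\}$ is open for every open $V\subseteq\mathbb R$, and whose graph $\{(x,y):y\in\Phi(x)\}$ is minimal under inclusion among the graphs of such maps. $MU_{\mathcal A}(X)$ is $MU(X)$ with the topology of uniform convergence on the members of $\mathcal A$, with respect to the Hausdorff uniformity on the non-empty compact subsets of $\mathbb R$; $C_{\mathcal A}(X)$ is the set of continuous functions $X\to\mathbb R$ with the topology of uniform convergence on the members of $\mathcal A$. The symbol $\mathbf 0$ denotes the constant map $\{0\}$ in $MU(X)$ and the constant function $0$ in the function space. **Statement.** Let $\mathcal A$ and $\mathcal B$ be ideals of closed subsets of $X$ with $X\notin\mathcal A$ and $X\notin\mathcal B$. (1) If $X$ is $\mathcal A$-normal, then $$\mathcal G:=\mathsf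 G_1(\mathcal O_X(\mathcal A),\mathcal O_X(\mathcal B))\equiv\mathsf G_1(\Omega_{MU_{\mathcal A}(X),\mathbf 0},\Omega_{MU_{\mathcal B}(X),\mathbf 0})\equiv\mathsf G_1(\mathscr D_{MU_{\mathcal A}(X)},\Omega_{MU_{\mathcal B}(X),\mathbf 0}),$$ $$\mathcal H:=\mathsf G_1(\mathscr N_X[\mathcal A],\neg\mathcal O_X(\mathcal B))\equiv\mathsf G_1(\mathscr N_{MU_{\mathcal A}(X),\mathbf 0},\neg\Omega_{MU_{\mathcal B}(X),\mathbf 0})\equiv\mathsf G_1(\mathscr T_{MU_{\mathcal A}(X)},\neg\Omega_{MU_{\mathcal B}(X),\mathbf 0}),$$ and $\mathcal G$ is dual to $\mathcal H$. (2) If $X$ is functionally $\mathcal A$-normal, then $$\begin{aligned}\mathsf G_1(\mathcal O_X(\mathcal A),\mathcal O_X(\mathcal B))&\equiv\mathsf G_1(\Omega_{MU_{\mathcal A}(X),\mathbf 0},\Omega_{MU_{\mathcal B}(X),\mathbf 0})\equiv\mathsf G_1(\Omega_{C_{\mathcal A}(X),\mathbf 0},\Omega_{C_{\mathcal B}(X),\mathbf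 0})\\&\equiv\mathsf G_1(\mathscr D_{MU_{\mathcal A}(X)},\Omega_{MU_{\mathcal B}(X),\mathbf 0})\equiv\mathsf G_1(\mathscr D_{C_{\mathcal A}(X)},\Omega_{C_{\mathcal B}(X),\mathbf 0})\end{aligned}$$ and $$\begin{aligned}\mathsf G_1(\mathscr N_X[\mathcal A],\neg\mathcal O_X(\mathcal B))&\equiv\mathsf G_1(\mathscr N_{MU_{\mathcal A}(X),\mathbf 0},\neg\Omega_{MU_{\mathcal B}(X),\mathbf 0})\equiv\mathsf G_1(\mathscr N_{C_{\mathcal A}(X),\mathbf 0},\neg\Omega_{C_{\mathcal B}(X),\mathbf 0})\\&\equiv\mathsf G_1(\mathscr T_{MU_{\mathcal A}(X)},\neg\Omega_{MU_{\mathcal B}(X),\mathbf 0})\equiv\mathsf G_1(\mathscr T_{C_{\mathcal A}(X)},\neg\Omega_{C_{\mathcal B}(X),\mathbf 0}).\end{aligned}$$ -/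

import Mathlib

open Set Topology TopologicalSpace

/-- The data of a single-selection game `G₁(moves, goal)`: in round `n` player One picks a member
`Aₙ` of `moves`, Two answers with a point `xₙ ∈ Aₙ`, and Two wins the play iff
`{xₙ : n ∈ ℕ} ∈ goal`. -/
structure SelectionGame (α : Type*) where
  moves : Set (Set α)
  goal : Set (Set α)

namespace SelectionGame

/-- `I ↑ G`: One has a winning full-information strategy, a map from finite sequences in `⋃ moves`
to `moves`, evaluated in round `n` at Two's answers `⟨x₀, …, xₙ₋₁⟩`. -/
def OneWins {α : Type*} (G : SelectionGame α) : Prop :=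
  ∃ σ : List ↥(⋃₀ G.moves) → ↥G.moves,
    ∀ x : ℕ → ↥(⋃₀ G.moves),
      (∀ n, (x n : α) ∈ (σ (List.ofFn fun i : Fin n => x i) : Set α)) →
        range (fun n => (x n : α)) ∉ G.goal

/-- `II ↑ G`: Two has a winning full-information strategy, a map from finite sequences in `moves`
to `⋃ moves`, evaluated in round `n` at One's choices `⟨A₀, …, Aₙ⟩`.  The answers have to obey the
rule `xₙ ∈ Aₙ`. -/
def TwoWins {α : Type*} (G : SelectionGame α) : Prop :=
  ∃ τ : List ↥G.moves → ↥(⋃₀ G.moves),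
    ∀ A : ℕ → ↥G.moves,
      (∀ n, (τ (List.ofFn fun i : Fin (n + 1) => A i) : α) ∈ (A n : Set α)) ∧
        range (fun n => (τ (List.ofFn fun i : Fin (n + 1) => A i) : α)) ∈ G.goal

/-- One has a winning predetermined strategy (depending only on the round). -/
def OneWinsPre {α : Type*} (G : SelectionGame α) : Prop :=
  ∃ σ : ℕ → ↥G.moves,
    ∀ x : ℕ → α, (∀ n, x n ∈ (σ n : Set α)) → range x ∉ G.goal

/-- Two has a winning Markov strategy (depending only on One's last move and the round).  The
answers have to obey the rule `xₙ ∈ Aₙ`. -/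
def TwoWinsMark {α : Type*} (G : SelectionGame α) : Prop :=
  ∃ τ : ↥G.moves → ℕ → ↥(⋃₀ G.moves),
    ∀ A : ℕ → ↥G.moves,
      (∀ n, (τ (A n) n : α) ∈ (A n : Set α)) ∧
        range (fun n => (τ (A n) n : α)) ∈ G.goal

/-- Equivalence of selection games. -/
def Equivalent {α β : Type*} (G : SelectionGame α) (H : SelectionGame β) : Prop :=
  (G.TwoWinsMark ↔ H.TwoWinsMark) ∧
  (G.TwoWins ↔ H.TwoWins) ∧
  (¬ G.OneWins ↔ ¬ H.OneWins) ∧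
  (¬ G.OneWinsPre ↔ ¬ H.OneWinsPre)

/-- Duality of selection games. -/
def Dual {α β : Type*} (G : SelectionGame α) (H : SelectionGame β) : Prop :=
  (G.OneWins ↔ H.TwoWins) ∧
  (G.TwoWins ↔ H.OneWins) ∧
  (G.OneWinsPre ↔ H.TwoWinsMark) ∧
  (G.TwoWinsMark ↔ H.OneWinsPre)

end SelectionGame

/-- An ideal of closed sets: a family of non-empty closed sets that is closed under binary unions
and contains all singletons. -/
structure IsClosedIdeal {X : Type*} [TopologicalSpace X] (𝒜 : Set (Set X)) : Prop where
  nonempty : ∀ A ∈ 𝒜, A.Nonempty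
  isClosed : ∀ A ∈ 𝒜, IsClosed A
  union : ∀ A ∈ 𝒜, ∀ B ∈ 𝒜, A ∪ B ∈ 𝒜
  singleton : ∀ x : X, {x} ∈ 𝒜

/-- `X` is `𝒜`-normal. -/
def FamilyNormal {X : Type*} [TopologicalSpace X] (𝒜 : Set (Set X)) : Prop :=
  ∀ A ∈ 𝒜, ∀ U : Set X, IsOpen U → A ⊆ U →
    ∃ V : Set X, IsOpen V ∧ A ⊆ V ∧ closure V ⊆ U

/-- `X` is functionally `𝒜`-normal. -/
def FunctionallyFamilyNormal {X : Type*} [TopologicalSpace X] (𝒜 : Set (Set X)) : Prop :=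
  ∀ A ∈ 𝒜, ∀ U : Set X, IsOpen U → A ⊆ U →
    ∃ f : X → ℝ, Continuous f ∧ (∀ x ∈ A, f x = 0) ∧ (∀ x ∉ U, f x = 1)

/-- `𝒪_X(𝒜)`: the open covers of `X`, containing neither `∅` nor `X`, such that every member of
`𝒜` is contained in a member of the cover. -/
def familyCovers {X : Type*} [TopologicalSpace X] (𝒜 : Set (Set X)) : Set (Set (Set X)) :=
  {𝒰 | (∀ U ∈ 𝒰, IsOpen U) ∧ ⋃₀ 𝒰 = univ ∧ ∅ ∉ 𝒰 ∧ univ ∉ 𝒰 ∧ ∀ A ∈ 𝒜, ∃ U ∈ 𝒰, A ⊆ U}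

/-- `𝒯`: the proper non-empty open sets.  The topology is an explicit argument here and in the
next definitions since several topologies on the same set are considered at once. -/
def properOpens {α : Type*} (t : TopologicalSpace α) : Set (Set α) :=
  {U | IsOpen[t] U ∧ U.Nonempty ∧ U ≠ univ}

/-- `𝒩_x`: the proper open sets that contain the point `x`. -/
def properNhds {α : Type*} (t : TopologicalSpace α) (x : α) : Set (Set α) :=
  {U | U ∈ properOpens t ∧ x ∈ U}

/-- `𝒩_X(A)`: the proper non-empty open sets that contain the set `A`. -/
def properSetNhds {X : Type*} [t : TopologicalSpace X] (A : Set X) : Set (Set X) :=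
  {U | U ∈ properOpens t ∧ A ⊆ U}

/-- `𝒩_X[𝒜] = {𝒩_X(A) : A ∈ 𝒜}`. -/
def familyNhds {X : Type*} [TopologicalSpace X] (𝒜 : Set (Set X)) : Set (Set (Set X)) :=
  properSetNhds '' 𝒜

/-- `Ω_x`: the sets that have `x` in their closure. -/
def clusterSets {α : Type*} (t : TopologicalSpace α) (x : α) : Set (Set α) :=
  {S | x ∈ closure[t] S}

/-- `𝒟`: the dense sets. -/
def denseSets {α : Type*} (t : TopologicalSpace α) : Set (Set α) :=
  {S | @Dense α t S}

/-- Usco maps from `X` to `Y`: upper semicontinuous maps with non-empty compact values. -/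
def IsUsco {X Y : Type*} [TopologicalSpace X] [TopologicalSpace Y]
    (Φ : X → NonemptyCompacts Y) : Prop :=
  ∀ V : Set Y, IsOpen V → IsOpen {x | (Φ x : Set Y) ⊆ V}

/-- The graph of a set-valued map. -/
def uscoGraph {X Y : Type*} [TopologicalSpace Y] (Φ : X → NonemptyCompacts Y) : Set (X × Y) :=
  {p | p.2 ∈ Φ p.1}

/-- Minimal usco maps: usco maps whose graph is minimal, with respect to inclusion, among the
graphs of usco maps. -/
def IsMinimalUsco {X Y : Type*} [TopologicalSpace X] [TopologicalSpace Y]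
    (Φ : X → NonemptyCompacts Y) : Prop :=
  IsUsco Φ ∧ ∀ Ψ : X → NonemptyCompacts Y, IsUsco Ψ → uscoGraph Ψ ⊆ uscoGraph Φ →
    uscoGraph Ψ = uscoGraph Φ

/-- `MU(X)`: the set of minimal usco maps from `X` to `ℝ`. -/
def MU (X : Type*) [TopologicalSpace X] : Type _ :=
  {Φ : X → NonemptyCompacts ℝ // IsMinimalUsco Φ}

theorem isMinimalUsco_zero (X : Type*) [TopologicalSpace X] :
    IsMinimalUsco (fun _ : X => ({0} : NonemptyCompacts ℝ)) := by
  refine ⟨fun V _ => isOpen_const, fun Ψ _ hsub => hsub.antisymm ?_⟩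
  rintro ⟨x, y⟩ hy
  obtain ⟨z, hz⟩ := (Ψ x).nonempty
  have h1 : z ∈ ({0} : NonemptyCompacts ℝ) := hsub (show (x, z) ∈ uscoGraph Ψ from hz)
  have h2 : y ∈ ({0} : NonemptyCompacts ℝ) := hy
  have h3 : z = 0 := by simpa using h1
  have h4 : y = 0 := by simpa using h2
  subst h3 h4
  exact hz

/-- The usco map that is constantly `{0}`. -/
noncomputable def MU.zero (X : Type*) [TopologicalSpace X] : MU X :=
  ⟨fun _ => {0}, isMinimalUsco_zero X⟩

/-- The topology of `MU_𝒜(X)`, i.e. of uniform convergence on the members of `𝒜`, where the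
non-empty compact subsets of `ℝ` carry the Hausdorff uniformity (generated by the entourages
`{(K, L) : K ⊆ E[L] ∧ L ⊆ E[K]}`). -/
noncomputable abbrev MU.topology {X : Type*} [TopologicalSpace X] (𝒜 : Set (Set X)) :
    TopologicalSpace (MU X) :=
  TopologicalSpace.induced (fun Φ : MU X => UniformOnFun.ofFun 𝒜 Φ.1) inferInstance

/-- The topology of `C_𝒜(X)`, i.e. of uniform convergence on the members of `𝒜`, on the set of
continuous real-valued functions. -/
noncomputable abbrev contTopology {X : Type*} [TopologicalSpace X] (𝒜 : Set (Set X)) :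
    TopologicalSpace C(X, ℝ) :=
  TopologicalSpace.induced (fun f : C(X, ℝ) => UniformOnFun.ofFun 𝒜 (f : X → ℝ)) inferInstance

/-- `G₁(𝒪_X(𝒜), 𝒪_X(ℬ))`. -/
def coverGame {X : Type*} [TopologicalSpace X] (𝒜 ℬ : Set (Set X)) : SelectionGame (Set X) :=
  ⟨familyCovers 𝒜, familyCovers ℬ⟩

/-- `G₁(𝒩_X[𝒜], ¬𝒪_X(ℬ))`. -/
def pointOpenGame {X : Type*} [TopologicalSpace X] (𝒜 ℬ : Set (Set X)) : SelectionGame (Set X) :=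
  ⟨familyNhds 𝒜, (familyCovers ℬ)ᶜ⟩

/-- For two topologies `s`, `t` on the same set: `G₁(Ω_{s,x}, Ω_{t,x})`. -/
def fanTightnessGame {α : Type*} (s t : TopologicalSpace α) (x : α) : SelectionGame α :=
  ⟨clusterSets s x, clusterSets t x⟩

/-- For two topologies `s`, `t` on the same set: `G₁(𝒟_s, Ω_{t,x})`. -/
def denseFanTightnessGame {α : Type*} (s t : TopologicalSpace α) (x : α) : SelectionGame α :=
  ⟨denseSets s, clusterSets t x⟩

/-- For two topologies `s`, `t` on the same set: `G₁(𝒩_{s,x}, ¬Ω_{t,x})`. -/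
def clusteringWGame {α : Type*} (s t : TopologicalSpace α) (x : α) : SelectionGame α :=
  ⟨properNhds s x, (clusterSets t x)ᶜ⟩

/-- For two topologies `s`, `t` on the same set: `G₁(𝒯_s, ¬Ω_{t,x})`. -/
def tkachukGame {α : Type*} (s t : TopologicalSpace α) (x : α) : SelectionGame α :=
  ⟨properOpens s, (clusterSets t x)ᶜ⟩

/-! Everything rests on the preorder `Le`, under which winning strategies of Two go forward and
those of One go back. `Le.of_translation` yields it from a round-by-round translation: a move of `H`
becomes a move of `G`, and an answer in `G` becomes an answer in `H`. The games on the covering side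
form a cycle: cover game ≤ fan tightness game ≤ dense game ≤ cover game. For the first link, a
minimal usco map `Φ` gives the open set where its values lie within `1/(n+1)` of `0`; a set
clustering at `0` thus gives a cover. The second link holds since dense sets cluster at every point.
For the third, a cover gives the set of those maps that equal `{1}` off some member of it. That set
is dense: by normality there is an open `V ⊇ A` with closure in a member, and a minimal usco map can
be kept on `V` and made `{1}` off the closure of `V`. For continuous functions, `f ↦ {f}` embeds
`C_𝒜(X)` in `MU_𝒜(X)`, and functional normality supplies the function that makes the analogous set
dense. The games with complementary goals follow by duality: selections from neighbourhoods are
exactly what One plays on the other side, up to shrinking (`dual_of_selections`). -/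

namespace SelectionGame

/-! ### Strategies as causal maps and their translation -/

/-- A causal map of sequences, given by a recursion that consults strictly earlier values. -/
theorem exists_causal_fixpoint {β γ : Type*} [Nonempty γ] (F : (ℕ → β) → (ℕ → γ) → ℕ → γ)
    (hF : ∀ b b' x x' n, (∀ i ≤ n, b i = b' i) → (∀ i < n, x i = x' i) → F b x n = F b' x' n) :
    ∃ T : (ℕ → β) → ℕ → γ,
      (∀ b b' n, (∀ i ≤ n, b i = b' i) → T b n = T b' n) ∧ ∀ b n, T b n = F b (T b) n := by
  classical
  let c : γ := Classical.arbitrary γ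
  -- Entries from index `n` on are filled with the default `c`, which `F` cannot see in round `n`.
  let T : (ℕ → β) → ℕ → γ := fun b n =>
    Nat.strongRecOn (motive := fun _ => γ) n fun n ih =>
      F b (fun m => if h : m < n then ih m h else c) n
  have hT : ∀ b n, T b n = F b (T b) n := by
    intro b n
    have h : T b n = F b (fun m => if _ : m < n then T b m else c) n := by
      simp only [T]
      rw [Nat.strongRecOn_eq]
    rw [h]
    exact hF _ _ _ _ _ (fun _ _ => rfl) fun i hi => by simp [hi]
  refine ⟨T, fun b b' n => ?_, hT⟩
  induction n using Nat.strongRecOn with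
  | ind n ih =>
    intro h
    rw [hT b, hT b']
    exact hF _ _ _ _ _ h fun i hi => ih i hi fun j hj => h j (hj.trans hi.le)

variable {α β : Type*} {G : SelectionGame α} {H : SelectionGame β}

/-- Maps of infinite plays that only look at an initial segment can be composed and updated without
handling lists. -/
theorem twoWins_iff_causal (hne : (⋃₀ G.moves).Nonempty) :
    G.TwoWins ↔ ∃ T : (ℕ → ↥G.moves) → ℕ → α,
      (∀ A A' n, (∀ i ≤ n, A i = A' i) → T A n = T A' n) ∧
        ∀ A, (∀ n, T A n ∈ (A n : Set α)) ∧ range (T A) ∈ G.goal := by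
  classical
  obtain ⟨d, A₀, hA₀, hd⟩ := hne
  constructor
  · rintro ⟨τ, hτ⟩
    refine ⟨fun A n => τ (List.ofFn fun i : Fin (n + 1) => A i), fun A A' n h => ?_, hτ⟩
    have : (fun i : Fin (n + 1) => A i) = fun i : Fin (n + 1) => A' i :=
      funext fun i => h i (Nat.lt_succ_iff.mp i.2)
    simp only [this]
  · rintro ⟨T, hT, hwin⟩
    -- Padding a finite history by a default move is harmless, since `T` ignores later moves.
    let ext : List ↥G.moves → ℕ → ↥G.moves := fun L i => L.getD i ⟨A₀, hA₀⟩
    have hext : ∀ (A : ℕ → ↥G.moves) (n : ℕ),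
        T (ext (List.ofFn fun i : Fin (n + 1) => A i)) n = T A n := by
      intro A n
      refine hT _ _ _ fun i hi => ?_
      simp [ext, List.getD, Nat.lt_succ_of_le hi, -List.ofFn_succ]
    -- In round `n` Two has already seen `n + 1` moves, hence the `- 1`.
    refine ⟨fun L => ⟨T (ext L) (L.length - 1), _, (ext L (L.length - 1)).2,
      (hwin (ext L)).1 _⟩, fun A => ?_⟩
    have : ∀ n, T (ext (List.ofFn fun i : Fin (n + 1) => A i))
        ((List.ofFn fun i : Fin (n + 1) => A i).length - 1) = T A n := by
      intro n
      simpa using hext A n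
    simp only [this]
    exact hwin A

theorem oneWins_iff_causal (hne : (⋃₀ G.moves).Nonempty) :
    G.OneWins ↔ ∃ S : (ℕ → α) → ℕ → ↥G.moves,
      (∀ x x' n, (∀ i < n, x i = x' i) → S x n = S x' n) ∧
        ∀ x, (∀ n, x n ∈ (S x n : Set α)) → range x ∉ G.goal := by
  classical
  obtain ⟨d, hd⟩ := hne
  constructor
  · rintro ⟨σ, hσ⟩
    let e : α → ↥(⋃₀ G.moves) := fun a => if h : a ∈ ⋃₀ G.moves then ⟨a, h⟩ else ⟨d, hd⟩
    refine ⟨fun x n => σ (List.ofFn fun i : Fin n => e (x i)), fun x x' n h => ?_, fun x hx => ?_⟩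
    · have : (fun i : Fin n => e (x i)) = fun i : Fin n => e (x' i) :=
        funext fun i => congrArg e (h i i.2)
      simp only [this]
    · have he : ∀ n, (e (x n) : α) = x n := by
        intro n
        have : x n ∈ ⋃₀ G.moves := ⟨_, (σ _).2, hx n⟩
        simp only [e, dif_pos this]
      have := hσ (fun n => e (x n)) fun n => by rw [he]; exact hx n
      simpa only [he] using this
  · rintro ⟨S, hS, hwin⟩
    let ext : List ↥(⋃₀ G.moves) → ℕ → α := fun L i => L.getD i ⟨d, hd⟩
    refine ⟨fun L => S (ext L) L.length, fun x hx => hwin (fun n => x n) fun n => ?_⟩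
    have := hx n
    simp only [List.length_ofFn] at this
    rwa [hS (fun n => (x n : α)) (ext (List.ofFn fun i : Fin n => x i)) n fun i hi => ?_]
    simp [ext, List.getD, hi]

theorem TwoWinsMark.mem {τ : ↥G.moves → ℕ → ↥(⋃₀ G.moves)}
    (hτ : ∀ A : ℕ → ↥G.moves,
      (∀ n, (τ (A n) n : α) ∈ (A n : Set α)) ∧ range (fun n => (τ (A n) n : α)) ∈ G.goal)
    (A : ↥G.moves) (n : ℕ) : (τ A n : α) ∈ (A : Set α) :=
  (hτ fun _ => A).1 n

/-- Winning strategies of Two pass from `G` to `H`, and those of One pass from `H` to `G`. -/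
structure Le (G : SelectionGame α) (H : SelectionGame β) : Prop where
  mark : G.TwoWinsMark → H.TwoWinsMark
  two : G.TwoWins → H.TwoWins
  one : H.OneWins → G.OneWins
  pre : H.OneWinsPre → G.OneWinsPre

theorem Le.trans {γ : Type*} {K : SelectionGame γ} (h : G.Le H) (h' : H.Le K) : G.Le K :=
  ⟨h'.mark ∘ h.mark, h'.two ∘ h.two, h.one ∘ h'.one, h.pre ∘ h'.pre⟩

theorem Le.equivalent (h : G.Le H) (h' : H.Le G) : G.Equivalent H :=
  ⟨⟨h.mark, h'.mark⟩, ⟨h.two, h'.two⟩, not_congr ⟨h'.one, h.one⟩, not_congr ⟨h'.pre, h.pre⟩⟩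

theorem Equivalent.of_dual {γ δ : Type*} {G' : SelectionGame γ} {H' : SelectionGame δ}
    (h : G.Equivalent H) (hG : G.Dual G') (hH : H.Dual H') : G'.Equivalent H' :=
  ⟨hG.2.2.1.symm.trans ((not_iff_not.mp h.2.2.2).trans hH.2.2.1),
    hG.1.symm.trans ((not_iff_not.mp h.2.2.1).trans hH.1),
    not_congr (hG.2.1.symm.trans (h.2.1.trans hH.2.1)),
    not_congr (hG.2.2.2.symm.trans (h.1.trans hH.2.2.2))⟩

/-- Translation of strategies, round by round. -/
theorem Le.of_translation (hG : (⋃₀ G.moves).Nonempty) (hH : (⋃₀ H.moves).Nonempty)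
    (φ : ℕ → ↥H.moves → ↥G.moves) (ψ : ℕ → ↥H.moves → α → β)
    (hψ : ∀ n B, ∀ x ∈ (φ n B : Set α), ψ n B x ∈ (B : Set β))
    (hgoal : ∀ (B : ℕ → ↥H.moves) (x : ℕ → α), (∀ n, x n ∈ (φ n (B n) : Set α)) →
      range x ∈ G.goal → range (fun n => ψ n (B n) (x n)) ∈ H.goal) : G.Le H where
  mark := by
    rintro ⟨τ, hτ⟩
    have hm := TwoWinsMark.mem hτ
    exact ⟨fun B n => ⟨ψ n B (τ (φ n B) n), B, B.2, hψ _ _ _ (hm _ _)⟩, fun B =>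
      ⟨fun n => hψ _ _ _ (hm _ _), hgoal B _ (fun n => hm _ _) (hτ fun n => φ n (B n)).2⟩⟩
  two := by
    rw [twoWins_iff_causal hG, twoWins_iff_causal hH]
    rintro ⟨T, hT, hwin⟩
    refine ⟨fun B n => ψ n (B n) (T (fun m => φ m (B m)) n), fun B B' n h => ?_, fun B =>
      ⟨fun n => hψ _ _ _ ((hwin fun m => φ m (B m)).1 n), hgoal B _ (hwin _).1 (hwin _).2⟩⟩
    have : T (fun m => φ m (B m)) n = T (fun m => φ m (B' m)) n :=
      hT _ _ _ fun i hi => by simp only [h i hi]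
    simp only [this, h n le_rfl]
  one := by
    rw [oneWins_iff_causal hG, oneWins_iff_causal hH]
    rintro ⟨S, hS, hwin⟩
    have : Nonempty β := hH.nonempty
    -- The translated answers depend on One's moves in `H`, which depend on earlier translated
    -- answers; causality makes this recursion well-founded.
    obtain ⟨Y, hYc, hY⟩ := exists_causal_fixpoint
      (fun (x : ℕ → α) (y : ℕ → β) n => ψ n (S y n) (x n)) fun x x' y y' n h h' => by
        simp only [hS y y' n h', h n le_rfl]
    refine ⟨fun x n => φ n (S (Y x) n), fun x x' n h => ?_, fun x hx hg => ?_⟩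
    · exact congrArg (φ n) <| hS (Y x) (Y x') n fun i hi =>
        hYc _ _ _ fun j hj => h j (hj.trans_lt hi)
    · refine hwin (Y x) (fun n => ?_) ?_
      · rw [hY]
        exact hψ _ _ _ (hx n)
      · rw [show Y x = fun n => ψ n (S (Y x) n) (x n) from funext fun n => hY x n]
        exact hgoal _ _ hx hg
  pre := by
    rintro ⟨σ, hσ⟩
    exact ⟨fun n => φ n (σ n), fun x hx hg =>
      hσ (fun n => ψ n (σ n) (x n)) (fun n => hψ _ _ _ (hx n)) (hgoal _ _ hx hg)⟩

theorem Le.of_moves_subset {H : SelectionGame α} (hne : (⋃₀ H.moves).Nonempty)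
    (hm : H.moves ⊆ G.moves) (hg : G.goal ⊆ H.goal) : G.Le H :=
  .of_translation (hne.mono (sUnion_subset_sUnion hm)) hne (fun _ B => ⟨B, hm B.2⟩)
    (fun _ _ x => x) (fun _ _ _ hx => hx) fun _ _ _ h => hg h

/-! ### Duality of abstract games -/

section Duality

variable {H : SelectionGame α}

/-- Two runs One's strategy for `G` alongside the play of `H` and answers with a point common to the
simulated and the actual move; the play then loses for Two in `G`. -/
theorem twoWins_of_oneWins (hG : (⋃₀ G.moves).Nonempty) (hH : (⋃₀ H.moves).Nonempty)
    (hmeet : ∀ A ∈ G.moves, ∀ R ∈ H.moves, (A ∩ R).Nonempty)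
    (hgoal : ∀ s, s ∉ G.goal → s ∈ H.goal) (h : G.OneWins) : H.TwoWins := by
  rw [oneWins_iff_causal hG] at h
  rw [twoWins_iff_causal hH]
  obtain ⟨S, hS, hwin⟩ := h
  have : Nonempty α := hG.nonempty
  choose p hp using fun (A : ↥G.moves) (R : ↥H.moves) => hmeet A A.2 R R.2
  obtain ⟨T, hTc, hT⟩ := exists_causal_fixpoint
    (fun (R : ℕ → ↥H.moves) (x : ℕ → α) n => p (S x n) (R n)) fun R R' x x' n h h' => by
      simp only [hS x x' n h', h n le_rfl]
  refine ⟨T, hTc, fun R => ⟨fun n => ?_, hgoal _ (hwin _ fun n => ?_)⟩⟩ <;> rw [hT]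
  exacts [(hp _ _).2, (hp _ _).1]

theorem twoWinsMark_of_oneWinsPre
    (hmeet : ∀ A ∈ G.moves, ∀ R ∈ H.moves, (A ∩ R).Nonempty)
    (hgoal : ∀ s, s ∉ G.goal → s ∈ H.goal) (h : G.OneWinsPre) : H.TwoWinsMark := by
  obtain ⟨σ, hσ⟩ := h
  choose p hp using fun (A : ↥G.moves) (R : ↥H.moves) => hmeet A A.2 R R.2
  exact ⟨fun R n => ⟨p (σ n) R, R, R.2, (hp _ _).2⟩, fun R =>
    ⟨fun n => (hp _ _).2, hgoal _ (hσ _ fun n => (hp _ _).1)⟩⟩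

/-- Round `n` of a Markov strategy is a selection from `G.moves`, so One can play a move inside its
range. Every reply is then an answer of the Markov strategy to some move. -/
theorem oneWinsPre_of_twoWinsMark
    (hsel : ∀ f : ↥G.moves → α, (∀ A : ↥G.moves, f A ∈ (A : Set α)) → ∃ R ∈ H.moves, R ⊆ range f)
    (hgoal : ∀ s, s ∈ G.goal → s ∉ H.goal) (h : G.TwoWinsMark) : H.OneWinsPre := by
  obtain ⟨τ, hτ⟩ := h
  choose R hR hRτ using fun n => hsel (fun A => τ A n) fun A : ↥G.moves => TwoWinsMark.mem hτ A n
  refine ⟨fun n => ⟨R n, hR n⟩, fun x hx => hgoal _ ?_⟩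
  choose A hA using fun n => hRτ n (hx n)
  rw [show x = fun n => (τ (A n) n : α) from funext fun n => (hA n).symm]
  exact (hτ A).2

/-- As in the Markov case, except that the selection in round `n` depends on the earlier moves in
`G`, which have to be recovered from the points played so far. -/
theorem oneWins_of_twoWins (hG : (⋃₀ G.moves).Nonempty) (hH : (⋃₀ H.moves).Nonempty)
    (hsel : ∀ f : ↥G.moves → α, (∀ A : ↥G.moves, f A ∈ (A : Set α)) → ∃ R ∈ H.moves, R ⊆ range f)
    (hgoal : ∀ s, s ∈ G.goal → s ∉ H.goal) (h : G.TwoWins) : H.OneWins := by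
  classical
  rw [twoWins_iff_causal hG] at h
  rw [oneWins_iff_causal hH]
  obtain ⟨T, hTc, hwin⟩ := h
  obtain ⟨-, A₀, hA₀, -⟩ := hG
  have : Nonempty ↥G.moves := ⟨⟨A₀, hA₀⟩⟩
  let next : (ℕ → ↥G.moves) → ℕ → ↥G.moves → α := fun A n B => T (Function.update A n B) n
  have hnext : ∀ A A' n, (∀ i < n, A i = A' i) → next A n = next A' n := by
    intro A A' n h
    funext B
    refine hTc _ _ _ fun i hi => ?_
    rcases hi.lt_or_eq with hi | rfl
    · simp [Function.update_of_ne hi.ne, h i hi]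
    · simp
  have hmem : ∀ (A : ℕ → ↥G.moves) n (B : ↥G.moves), next A n B ∈ (B : Set α) := by
    intro A n B
    simpa using (hwin (Function.update A n B)).1 n
  -- `P x` is a play of `G` against which `T` produces `x`, as long as each `x n` is a possible
  -- answer.
  obtain ⟨P, hPc, hP⟩ := exists_causal_fixpoint
    (fun (x : ℕ → α) (A : ℕ → ↥G.moves) n => Classical.epsilon fun B => next A n B = x n)
    fun x x' A A' n h h' => by simp only [hnext A A' n h', h n le_rfl]
  let pick : {f : ↥G.moves → α // ∀ A : ↥G.moves, f A ∈ (A : Set α)} → ↥H.moves :=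
    fun f => ⟨_, (hsel f f.2).choose_spec.1⟩
  have hpick : ∀ f, (pick f : Set α) ⊆ range f.1 := fun f => (hsel f f.2).choose_spec.2
  refine ⟨fun x n => pick ⟨next (P x) n, hmem _ _⟩, fun x x' n h => ?_, fun x hx => hgoal _ ?_⟩
  · refine congrArg pick (Subtype.ext ?_)
    exact hnext _ _ _ fun i hi => hPc _ _ _ fun j hj => h j (hj.trans_lt hi)
  · have hx' : x = T (P x) := by
      funext n
      have h1 : next (P x) n (P x n) = x n := by
        conv_lhs => rw [hP x n]
        exact Classical.epsilon_spec (p := fun B => next (P x) n B = x n) (hpick _ (hx n))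
      rw [← h1]
      simp [next]
    rw [hx']
    exact (hwin _).2

/-- Two games with complementary goals are dual if the moves of the second one are, up to
shrinking, the selections from the moves of the first one. -/
theorem dual_of_selections {𝒬 ℛ : Set (Set α)} (𝒲 : Set (Set α))
    (hP : (⋃₀ 𝒬).Nonempty) (hR : (⋃₀ ℛ).Nonempty)
    (hmeet : ∀ A ∈ 𝒬, ∀ R ∈ ℛ, (A ∩ R).Nonempty)
    (hsel : ∀ f : ↥ℛ → α, (∀ R : ↥ℛ, f R ∈ (R : Set α)) → range f ∈ 𝒬) :
    (⟨𝒬, 𝒲⟩ : SelectionGame α).Dual ⟨ℛ, 𝒲ᶜ⟩ := by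
  have hmeet' : ∀ R ∈ ℛ, ∀ A ∈ 𝒬, (R ∩ A).Nonempty := fun R hR A hA => by
    rw [inter_comm]
    exact hmeet A hA R hR
  have hsel₁ : ∀ f : ↥ℛ → α, (∀ R : ↥ℛ, f R ∈ (R : Set α)) → ∃ A ∈ 𝒬, A ⊆ range f :=
    fun f hf => ⟨_, hsel f hf, Subset.rfl⟩
  have hsel₂ : ∀ f : ↥𝒬 → α, (∀ A : ↥𝒬, f A ∈ (A : Set α)) → ∃ R ∈ ℛ, R ⊆ range f := by
    intro f hf
    -- Otherwise each `R` has a point outside the range of `f`. These points form a member of `𝒬`,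
    -- and the value of `f` at it is one of them.
    by_contra! hcon
    choose g hg hgf using fun R : ↥ℛ => not_subset.mp (hcon R R.2)
    obtain ⟨R, hR⟩ := hf ⟨range g, hsel g hg⟩
    exact hgf R (hR ▸ mem_range_self _)
  exact ⟨⟨twoWins_of_oneWins hP hR hmeet fun _ h => h,
      oneWins_of_twoWins hR hP hsel₁ fun _ h => h⟩,
    ⟨oneWins_of_twoWins hP hR hsel₂ fun _ h => not_not.mpr h,
      twoWins_of_oneWins hR hP hmeet' fun _ h => not_not.mp h⟩,
    ⟨twoWinsMark_of_oneWinsPre hmeet fun _ h => h,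
      oneWinsPre_of_twoWinsMark hsel₁ fun _ h => h⟩,
    ⟨oneWinsPre_of_twoWinsMark hsel₂ fun _ h => not_not.mpr h,
      twoWinsMark_of_oneWinsPre hmeet' fun _ h => not_not.mp h⟩⟩

end Duality

end SelectionGame

open scoped Uniformity

/-! ### Minimal usco maps -/

section Usco

variable {X Y : Type*} [TopologicalSpace X] [TopologicalSpace Y]

/-- Every usco map contains a minimal one. -/
theorem IsUsco.exists_minimal_le [T2Space Y] {Φ : X → NonemptyCompacts Y} (hΦ : IsUsco Φ) :
    ∃ Ψ : X → NonemptyCompacts Y, IsMinimalUsco Ψ ∧ ∀ x, (Ψ x : Set Y) ⊆ Φ x := by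
  classical
  -- Zorn in the reversed order: the lower bound of a chain is its pointwise intersection, non-empty
  -- by compactness.
  have key := zorn_le_nonempty₀ (α := (X → NonemptyCompacts Y)ᵒᵈ)
    {Ψ | IsUsco (OrderDual.ofDual Ψ)} (fun c hc hchain Θ hΘ => ?_) (OrderDual.toDual Φ) hΦ
  · obtain ⟨Ψ, hΨΦ, hΨ, hmax⟩ := key
    refine ⟨OrderDual.ofDual Ψ, ⟨hΨ, fun Θ hΘ hsub => hsub.antisymm ?_⟩, fun x => hΨΦ x⟩
    have h1 : Ψ ≤ OrderDual.toDual Θ := fun x y hy => hsub (show (x, y) ∈ uscoGraph Θ from hy)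
    exact fun p hp => hmax hΘ h1 p.1 hp
  · have : Nonempty c := ⟨⟨Θ, hΘ⟩⟩
    have hdir : ∀ x, Directed (· ⊇ ·) fun Ψ : c =>
        ((OrderDual.ofDual Ψ.1 x : NonemptyCompacts Y) : Set Y) := by
      intro x Ψ₁ Ψ₂
      rcases hchain.total Ψ₁.2 Ψ₂.2 with h | h
      · exact ⟨Ψ₂, h x, Subset.rfl⟩
      · exact ⟨Ψ₁, Subset.rfl, h x⟩
    let I : X → NonemptyCompacts Y := fun x =>
      ⟨⟨⋂ Ψ : c, ((OrderDual.ofDual Ψ.1 x : NonemptyCompacts Y) : Set Y),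
        (OrderDual.ofDual Θ x).isCompact.of_isClosed_subset
          (isClosed_iInter fun Ψ => (OrderDual.ofDual Ψ.1 x).isCompact.isClosed)
          (iInter_subset_of_subset ⟨Θ, hΘ⟩ Subset.rfl)⟩,
        IsCompact.nonempty_iInter_of_directed_nonempty_isCompact_isClosed _ (hdir x)
          (fun Ψ => (OrderDual.ofDual Ψ.1 x).nonempty)
          (fun Ψ => (OrderDual.ofDual Ψ.1 x).isCompact)
          (fun Ψ => (OrderDual.ofDual Ψ.1 x).isCompact.isClosed)⟩
    have hI : ∀ x, (I x : Set Y) = ⋂ Ψ : c, ((OrderDual.ofDual Ψ.1 x : NonemptyCompacts Y) : Set Y) :=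
      fun _ => rfl
    refine ⟨OrderDual.toDual I, fun V hV => ?_, fun Ψ hΨ x => ?_⟩
    · have : {x | ((OrderDual.ofDual (OrderDual.toDual I) x : NonemptyCompacts Y) : Set Y) ⊆ V} =
          ⋃ Ψ : c, {x | ((OrderDual.ofDual Ψ.1 x : NonemptyCompacts Y) : Set Y) ⊆ V} := by
        ext x
        simp only [mem_iUnion, mem_ofPred_eq, OrderDual.ofDual_toDual, hI]
        constructor
        · intro h
          -- By compactness, an intersection of a directed family lies in the open `V` only if some
          -- member does.
          exact exists_subset_nhds_of_isCompact' (hdir x)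
            (fun Ψ => (OrderDual.ofDual Ψ.1 x).isCompact)
            (fun Ψ => (OrderDual.ofDual Ψ.1 x).isCompact.isClosed)
            fun y hy => hV.mem_nhds (h hy)
        · rintro ⟨Ψ, hΨ⟩
          exact (iInter_subset _ Ψ).trans hΨ
      rw [this]
      exact isOpen_iUnion fun Ψ => hc Ψ.2 V hV
    · exact iInter_subset (fun Ψ : c => ((OrderDual.ofDual Ψ.1 x : NonemptyCompacts Y) : Set Y)) ⟨Ψ, hΨ⟩

/-- A minimal usco map is minimal on every open set. -/
theorem IsMinimalUsco.eq_of_subset_on_open {Φ Ψ : X → NonemptyCompacts Y} (hΨ : IsMinimalUsco Ψ)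
    (hΦ : IsUsco Φ) {V : Set X} (hV : IsOpen V) (hsub : ∀ x ∈ V, (Φ x : Set Y) ⊆ Ψ x) :
    ∀ x ∈ V, Φ x = Ψ x := by
  classical
  -- Shrinking values on an open set keeps upper semicontinuity, so minimality of `Ψ` applies to
  -- this glued map.
  let Θ : X → NonemptyCompacts Y := fun x => if x ∈ V then Φ x else Ψ x
  have hle : ∀ x, (Θ x : Set Y) ⊆ Ψ x := by
    intro x
    by_cases hx : x ∈ V
    · simpa [Θ, hx] using hsub x hx
    · simp [Θ, hx]
  have hΘ : IsUsco Θ := by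
    intro W hW
    have : {x | (Θ x : Set Y) ⊆ W} =
        {x | (Ψ x : Set Y) ⊆ W} ∪ (V ∩ {x | (Φ x : Set Y) ⊆ W}) := by
      ext x
      by_cases hx : x ∈ V
      · simpa [Θ, hx] using fun h => (hsub x hx).trans h
      · simp [Θ, hx]
    rw [this]
    exact (hΨ.1 W hW).union (hV.inter (hΦ W hW))
  intro x hx
  have hg := hΨ.2 Θ hΘ fun p hp => hle p.1 hp
  ext y
  have : (x, y) ∈ uscoGraph Θ ↔ (x, y) ∈ uscoGraph Ψ := by rw [hg]
  simpa [uscoGraph, Θ, hx] using this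

/-- A minimal usco map can be made constant off the closure of an open set, without changing it on
that open set. -/
theorem IsMinimalUsco.exists_eqOn_open [T2Space Y] {Ψ : X → NonemptyCompacts Y}
    (hΨ : IsMinimalUsco Ψ) {V : Set X} (hV : IsOpen V) (y : Y) :
    ∃ Φ : X → NonemptyCompacts Y, IsMinimalUsco Φ ∧ (∀ x ∈ V, Φ x = Ψ x) ∧
      ∀ x ∉ closure V, Φ x = {y} := by
  classical
  -- On the boundary of `V` both values are needed for upper semicontinuity. A minimal map inside
  -- `Θ` is forced to be `Ψ` on `V` and `{y}` off the closure.
  let Θ : X → NonemptyCompacts Y := fun x =>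
    if x ∈ V then Ψ x else if x ∈ closure V then Ψ x ⊔ {y} else {y}
  have hΘ : IsUsco Θ := by
    intro W hW
    have : {x | (Θ x : Set Y) ⊆ W} =
        (V ∩ {x | (Ψ x : Set Y) ⊆ W}) ∪ ({x | (Ψ x : Set Y) ⊆ W} ∩ {_x | y ∈ W}) ∪
          ((closure V)ᶜ ∩ {_x | y ∈ W}) := by
      ext x
      by_cases hx : x ∈ V
      · have := subset_closure hx
        simp [Θ, hx, this]
        tauto
      · by_cases hx' : x ∈ closure V
        · simp [Θ, hx, hx', insert_subset_iff, and_comm]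
        · simp [Θ, hx, hx']
    rw [this]
    exact ((hV.inter (hΨ.1 W hW)).union ((hΨ.1 W hW).inter isOpen_const)).union
      (isClosed_closure.isOpen_compl.inter isOpen_const)
  obtain ⟨Φ, hΦ, hle⟩ := hΘ.exists_minimal_le
  refine ⟨Φ, hΦ, hΨ.eq_of_subset_on_open hΦ.1 hV fun x hx => ?_, fun x hx => ?_⟩
  · simpa [Θ, hx] using hle x
  · have hx' : x ∉ V := fun h => hx (subset_closure h)
    have : (Φ x : Set Y) ⊆ {y} := by simpa [Θ, hx, hx'] using hle x
    exact SetLike.coe_injective ((Φ x).nonempty.subset_singleton_iff.mp this)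

theorem isMinimalUsco_singleton {f : X → Y} (hf : Continuous f) :
    IsMinimalUsco fun x => ({f x} : NonemptyCompacts Y) := by
  refine ⟨fun V hV => ?_, fun Ψ _ hsub => hsub.antisymm ?_⟩
  · simpa [preimage] using hV.preimage hf
  · rintro ⟨x, y⟩ hy
    obtain ⟨z, hz⟩ := (Ψ x).nonempty
    have h1 : z = f x := by simpa [uscoGraph] using hsub (show (x, z) ∈ uscoGraph Ψ from hz)
    have h2 : y = f x := by simpa [uscoGraph] using hy
    rw [h2, ← h1]
    exact hz

end Usco

/-! ### The topologies of `MU_𝒜(X)` and `C_𝒜(X)` -/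

section SelectionPrinciples

variable {X : Type*} [TopologicalSpace X] {𝒜 : Set (Set X)}

/-- A continuous function as a single-valued minimal usco map. -/
noncomputable def MU.ofCont (f : C(X, ℝ)) : MU X :=
  ⟨fun x => {f x}, isMinimalUsco_singleton f.continuous⟩

/-- `y ↦ {y}` is a uniform embedding of `ℝ` into its compact subsets, and postcomposition preserves
this for uniform convergence on `𝒜`. -/
theorem contTopology_eq_induced (𝒜 : Set (Set X)) :
    contTopology 𝒜 = (MU.topology 𝒜).induced MU.ofCont := by
  have h := (UniformOnFun.postcomp_isUniformInducing (𝔖 := 𝒜)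
    (NonemptyCompacts.isUniformEmbedding_singleton (α := ℝ)).isUniformInducing).isInducing.eq_induced
  refine (congrArg (induced fun f : C(X, ℝ) => UniformOnFun.ofFun 𝒜 (f : X → ℝ)) h).trans ?_
  rw [MU.topology, induced_compose, induced_compose]
  rfl

theorem IsClosedIdeal.directedOn (h𝒜 : IsClosedIdeal 𝒜) : DirectedOn (· ⊆ ·) 𝒜 :=
  fun A hA B hB => ⟨A ∪ B, h𝒜.union A hA B hB, subset_union_left, subset_union_right⟩

theorem IsClosedIdeal.nonempty_family [Nonempty X] (h𝒜 : IsClosedIdeal 𝒜) : 𝒜.Nonempty :=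
  ⟨_, h𝒜.singleton (Classical.arbitrary X)⟩

theorem MU.hasBasis_nhds [Nonempty X] (h𝒜 : IsClosedIdeal 𝒜) (Ψ : MU X) :
    (@nhds _ (MU.topology 𝒜) Ψ).HasBasis
      (fun p : Set X × Set (NonemptyCompacts ℝ × NonemptyCompacts ℝ) =>
        p.1 ∈ 𝒜 ∧ p.2 ∈ 𝓤 (NonemptyCompacts ℝ))
      fun p => {Φ | ∀ x ∈ p.1, (Φ.1 x, Ψ.1 x) ∈ p.2} := by
  rw [nhds_induced]
  exact (UniformOnFun.hasBasis_nhds X (NonemptyCompacts ℝ) 𝒜 (UniformOnFun.ofFun 𝒜 Ψ.1)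
    h𝒜.nonempty_family h𝒜.directedOn).comap _

theorem MU.dense_of_forall_eqOn [Nonempty X] (h𝒜 : IsClosedIdeal 𝒜) {S : Set (MU X)}
    (h : ∀ Ψ : MU X, ∀ A ∈ 𝒜, ∃ Φ ∈ S, ∀ x ∈ A, Φ.1 x = Ψ.1 x) : S ∈ denseSets (MU.topology 𝒜) := by
  intro Ψ
  let _ := MU.topology 𝒜
  rw [mem_closure_iff_nhds_basis (MU.hasBasis_nhds h𝒜 Ψ)]
  rintro ⟨A, E⟩ ⟨hA, hE⟩
  obtain ⟨Φ, hΦ, heq⟩ := h Ψ A hA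
  exact ⟨Φ, hΦ, fun x hx => by rw [heq x hx]; exact refl_mem_uniformity hE⟩

/-- The second half of Hausdorff closeness is automatic: any point of the non-empty `K` is the
required point near `0`. -/
theorem mem_hausdorffEntourage_zero {K : NonemptyCompacts ℝ} {ε : ℝ} :
    (K, ({0} : NonemptyCompacts ℝ)) ∈ Prod.map ((↑) : NonemptyCompacts ℝ → Set ℝ) (↑) ⁻¹'
      hausdorffEntourage {p : ℝ × ℝ | dist p.1 p.2 < ε} ↔ (K : Set ℝ) ⊆ Metric.ball 0 ε := by
  rw [mem_preimage, Prod.map_apply, mem_hausdorffEntourage]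
  constructor
  · rintro ⟨h, -⟩ y hy
    obtain ⟨z, hz, hyz⟩ := h hy
    have hz : z = 0 := by simpa using hz
    subst hz
    exact hyz
  · intro h
    refine ⟨fun y hy => ⟨0, by simp, h hy⟩, fun z hz => ?_⟩
    have hz : z = 0 := by simpa using hz
    subst hz
    obtain ⟨y, hy⟩ := K.nonempty
    exact ⟨y, hy, h hy⟩

theorem MU.hasBasis_nhds_zero [Nonempty X] (h𝒜 : IsClosedIdeal 𝒜) :
    (@nhds _ (MU.topology 𝒜) (MU.zero X)).HasBasis (fun p : Set X × ℝ => p.1 ∈ 𝒜 ∧ 0 < p.2)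
      fun p => {Φ | ∀ x ∈ p.1, (Φ.1 x : Set ℝ) ⊆ Metric.ball 0 p.2} := by
  rw [nhds_induced]
  refine ((UniformOnFun.hasBasis_nhds_of_basis X (NonemptyCompacts ℝ) 𝒜
    (UniformOnFun.ofFun 𝒜 (MU.zero X).1) h𝒜.nonempty_family h𝒜.directedOn
    Metric.uniformity_basis_dist.uniformity_nonemptyCompacts).comap _).congr
    (fun _ => Iff.rfl) fun p _ => ?_
  ext Φ
  exact forall₂_congr fun x _ => mem_hausdorffEntourage_zero

theorem MU.mem_clusterSets_zero [Nonempty X] (h𝒜 : IsClosedIdeal 𝒜) {S : Set (MU X)} :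
    S ∈ clusterSets (MU.topology 𝒜) (MU.zero X) ↔
      ∀ A ∈ 𝒜, ∀ ε : ℝ, 0 < ε → ∃ Φ ∈ S, ∀ x ∈ A, (Φ.1 x : Set ℝ) ⊆ Metric.ball 0 ε := by
  let _ := MU.topology 𝒜
  rw [clusterSets, mem_ofPred_eq, mem_closure_iff_nhds_basis (MU.hasBasis_nhds_zero h𝒜)]
  exact ⟨fun h A hA ε hε => h (i := (A, ε)) ⟨hA, hε⟩, fun h p hp => h _ hp.1 _ hp.2⟩

/-! ### Duality of the function space games -/

section Duality

variable {α : Type*} (s t : TopologicalSpace α) (x : α)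

theorem fanTightnessGame_dual (h : (properNhds s x).Nonempty) :
    (fanTightnessGame s t x).Dual (clusteringWGame s t x) := by
  obtain ⟨U₀, hU₀⟩ := h
  refine SelectionGame.dual_of_selections _ ⟨x, {x}, @subset_closure α s _ _ rfl, rfl⟩
    ⟨x, U₀, hU₀, hU₀.2⟩ (fun A hA R hR => ?_) fun f hf => ?_
  · rw [inter_comm]
    exact (@mem_closure_iff α s _ _).mp hA R hR.1.1 hR.2
  · refine (@mem_closure_iff α s _ _).mpr fun U hU hx => ?_
    -- The whole space is not a proper open set; any selected point lies in it, and `U₀` provides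
    -- one.
    by_cases hne : U = univ
    · exact ⟨f ⟨U₀, hU₀⟩, hne ▸ mem_univ _, mem_range_self _⟩
    · exact ⟨f ⟨U, ⟨hU, ⟨x, hx⟩, hne⟩, hx⟩, hf ⟨U, _⟩, mem_range_self _⟩

theorem denseFanTightnessGame_dual (h : (properOpens s).Nonempty) :
    (denseFanTightnessGame s t x).Dual (tkachukGame s t x) := by
  obtain ⟨U₀, hU₀⟩ := h
  obtain ⟨a, ha⟩ := hU₀.2.1
  refine SelectionGame.dual_of_selections _ ⟨x, univ, @dense_univ α s, mem_univ x⟩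
    ⟨a, U₀, hU₀, ha⟩ (fun A hA R hR => ?_) fun f hf => ?_
  · rw [inter_comm]
    exact @Dense.inter_open_nonempty α s _ hA R hR.1 hR.2.1
  · refine (@dense_iff_inter_open α s _).mpr fun U hU hUne => ?_
    by_cases hne : U = univ
    · exact ⟨f ⟨U₀, hU₀⟩, hne ▸ mem_univ _, mem_range_self _⟩
    · exact ⟨f ⟨U, hU, hUne, hne⟩, hf ⟨U, _⟩, mem_range_self _⟩

end Duality

theorem denseSets_subset_clusterSets {α : Type*} (s : TopologicalSpace α) (x : α) :
    denseSets s ⊆ clusterSets s x :=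
  fun _ hS => hS x

theorem sUnion_denseSets_nonempty {α : Type*} (s : TopologicalSpace α) (x : α) :
    (⋃₀ denseSets s).Nonempty :=
  ⟨x, univ, dense_univ, mem_univ x⟩

theorem sUnion_clusterSets_nonempty {α : Type*} (s : TopologicalSpace α) (x : α) :
    (⋃₀ clusterSets s x).Nonempty :=
  ⟨x, {x}, subset_closure rfl, rfl⟩

theorem fanTightnessGame_le_dense {α : Type*} (s t : TopologicalSpace α) (x : α) :
    (fanTightnessGame s t x).Le (denseFanTightnessGame s t x) :=
  .of_moves_subset (sUnion_denseSets_nonempty s x) (denseSets_subset_clusterSets s x) Subset.rfl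

/-! ### Covers and the duality of the cover game -/

section Covers

/-- A cover that always exists; it makes the cover game playable and serves as a dummy move. -/
theorem compl_singletons_mem_familyCovers (h𝒜 : IsClosedIdeal 𝒜) (h𝒜X : univ ∉ 𝒜) :
    range (fun x : X => ({x}ᶜ : Set X)) ∈ familyCovers 𝒜 := by
  have hsub : ∀ A ∈ 𝒜, ∃ U ∈ range (fun x : X => ({x}ᶜ : Set X)), A ⊆ U := by
    intro A hA
    obtain ⟨x, hx⟩ := (ne_univ_iff_exists_notMem A).mp fun h => h𝒜X (h ▸ hA)
    exact ⟨_, mem_range_self x, subset_compl_singleton_iff.mpr hx⟩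
  refine ⟨?_, ?_, ?_, ?_, hsub⟩
  · rintro _ ⟨x, rfl⟩
    exact (h𝒜.isClosed _ (h𝒜.singleton x)).isOpen_compl
  · refine eq_univ_of_forall fun x => ?_
    obtain ⟨U, hU, hxU⟩ := hsub _ (h𝒜.singleton x)
    exact ⟨U, hU, hxU rfl⟩
  · rintro ⟨x, hx⟩
    exact h𝒜X (compl_empty_iff.mp hx ▸ h𝒜.singleton x)
  · rintro ⟨x, hx⟩
    exact (singleton_nonempty x).ne_empty (compl_univ_iff.mp hx)

theorem IsClosedIdeal.mem_familyCovers (h𝒜 : IsClosedIdeal 𝒜) {𝒰 : Set (Set X)}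
    (h𝒰 : ∀ U ∈ 𝒰, U ∈ properOpens ‹_›) (hsub : ∀ A ∈ 𝒜, ∃ U ∈ 𝒰, A ⊆ U) :
    𝒰 ∈ familyCovers 𝒜 := by
  refine ⟨fun U hU => (h𝒰 U hU).1, eq_univ_of_forall fun x => ?_,
    fun h => (h𝒰 _ h).2.1.ne_empty rfl, fun h => (h𝒰 _ h).2.2 rfl, hsub⟩
  obtain ⟨U, hU, hxU⟩ := hsub _ (h𝒜.singleton x)
  exact ⟨U, hU, hxU rfl⟩

theorem properOpens_of_mem_familyCovers {𝒰 : Set (Set X)} (h𝒰 : 𝒰 ∈ familyCovers 𝒜) {U : Set X}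
    (hU : U ∈ 𝒰) : U ∈ properOpens ‹_› :=
  ⟨h𝒰.1 U hU, nonempty_iff_ne_empty.mpr fun h => h𝒰.2.2.1 (h ▸ hU),
    fun h => h𝒰.2.2.2.1 (h ▸ hU)⟩

variable [Nonempty X]

theorem sUnion_familyCovers_nonempty (h𝒜 : IsClosedIdeal 𝒜) (h𝒜X : univ ∉ 𝒜) :
    (⋃₀ familyCovers 𝒜).Nonempty :=
  ⟨_, _, compl_singletons_mem_familyCovers h𝒜 h𝒜X, mem_range_self (Classical.arbitrary X)⟩

theorem coverGame_dual (h𝒜 : IsClosedIdeal 𝒜) (h𝒜X : univ ∉ 𝒜) (ℬ : Set (Set X)) :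
    (coverGame 𝒜 ℬ).Dual (pointOpenGame 𝒜 ℬ) := by
  have hmeet : ∀ 𝒰 ∈ familyCovers 𝒜, ∀ R ∈ familyNhds 𝒜, (𝒰 ∩ R).Nonempty := by
    rintro 𝒰 h𝒰 _ ⟨A, hA, rfl⟩
    obtain ⟨U, hU, hAU⟩ := h𝒰.2.2.2.2 A hA
    exact ⟨U, hU, properOpens_of_mem_familyCovers h𝒰 hU, hAU⟩
  refine SelectionGame.dual_of_selections _ (sUnion_familyCovers_nonempty h𝒜 h𝒜X) ?_ hmeet
    fun f hf => h𝒜.mem_familyCovers ?_ fun A hA => ?_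
  · obtain ⟨A, hA⟩ := h𝒜.nonempty_family
    obtain ⟨U, -, hU⟩ := hmeet _ (compl_singletons_mem_familyCovers h𝒜 h𝒜X) _ (mem_image_of_mem _ hA)
    exact ⟨U, _, mem_image_of_mem _ hA, hU⟩
  · rintro _ ⟨⟨_, A, hA, rfl⟩, rfl⟩
    exact (hf ⟨_, mem_image_of_mem _ hA⟩).1
  · exact ⟨_, mem_range_self ⟨_, mem_image_of_mem _ hA⟩, (hf ⟨_, mem_image_of_mem _ hA⟩).2⟩

end Covers

theorem FunctionallyFamilyNormal.familyNormal (h : FunctionallyFamilyNormal 𝒜) :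
    FamilyNormal 𝒜 := by
  intro A hA U hU hAU
  obtain ⟨f, hf, hf0, hf1⟩ := h A hA U hU hAU
  refine ⟨{x | f x < 1 / 2}, isOpen_lt hf continuous_const, fun x hx => ?_, fun x hx => ?_⟩
  · simp [hf0 x hx]
  · by_contra hxU
    have : f x ≤ 1 / 2 := closure_lt_subset_le hf continuous_const hx
    rw [hf1 x hxU] at this
    norm_num at this

/-! ### Translations between covers and functions -/

variable {ℬ : Set (Set X)}

theorem cont_mem_clusterSets_iff {S : Set C(X, ℝ)} :
    S ∈ clusterSets (contTopology 𝒜) 0 ↔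
      MU.ofCont '' S ∈ clusterSets (MU.topology 𝒜) (MU.zero X) := by
  simp only [clusterSets, mem_ofPred_eq]
  rw [contTopology_eq_induced, @closure_induced _ _ (MU.topology 𝒜)]
  rfl

theorem fanTightnessGame_le_cont :
    (fanTightnessGame (MU.topology 𝒜) (MU.topology ℬ) (MU.zero X)).Le
      (fanTightnessGame (contTopology 𝒜) (contTopology ℬ) (0 : C(X, ℝ))) := by
  refine .of_translation (sUnion_clusterSets_nonempty _ _) (sUnion_clusterSets_nonempty _ _)
    (fun _ S => ⟨MU.ofCont '' S, cont_mem_clusterSets_iff.mp S.2⟩)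
    (fun _ S Φ => Classical.epsilon fun f => f ∈ (S : Set C(X, ℝ)) ∧ MU.ofCont f = Φ)
    (fun _ S Φ hΦ => (Classical.epsilon_spec hΦ).1) fun S Φ hΦ hgoal => ?_
  refine cont_mem_clusterSets_iff.mpr ?_
  rw [← range_comp]
  convert! hgoal using 2
  exact funext fun n => (Classical.epsilon_spec (hΦ n)).2

variable [Nonempty X]

theorem MU.properNhds_nonempty (h𝒜 : IsClosedIdeal 𝒜) :
    ∃ U ∈ properNhds (MU.topology 𝒜) (MU.zero X), MU.ofCont 1 ∉ U := by
  let _ := MU.topology 𝒜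
  obtain ⟨A, hA⟩ := h𝒜.nonempty_family
  obtain ⟨a, ha⟩ := h𝒜.nonempty A hA
  obtain ⟨U, hUs, hU, h0⟩ :=
    mem_nhds_iff.mp ((MU.hasBasis_nhds_zero h𝒜).mem_of_mem (i := (A, 1)) ⟨hA, one_pos⟩)
  have h1 : MU.ofCont 1 ∉ U := by
    intro h
    have := hUs h a ha
    simp [MU.ofCont] at this
  exact ⟨U, ⟨⟨hU, ⟨_, h0⟩, fun h => h1 (h ▸ mem_univ _)⟩, h0⟩, h1⟩

theorem cont_properNhds_nonempty (h𝒜 : IsClosedIdeal 𝒜) :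
    (properNhds (contTopology 𝒜) (0 : C(X, ℝ))).Nonempty := by
  obtain ⟨U, ⟨⟨hU, -, -⟩, h0⟩, h1⟩ := MU.properNhds_nonempty h𝒜
  refine ⟨MU.ofCont ⁻¹' U, ⟨?_, ⟨0, h0⟩, fun h => h1 ?_⟩, h0⟩
  · rw [contTopology_eq_induced]
    exact isOpen_induced (t := MU.topology 𝒜) hU
  · exact (h ▸ mem_univ _ : (1 : C(X, ℝ)) ∈ MU.ofCont ⁻¹' U)

theorem coverGame_le_fanTightnessGame (h𝒜 : IsClosedIdeal 𝒜) (h𝒜X : univ ∉ 𝒜)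
    (hℬ : IsClosedIdeal ℬ) :
    (coverGame 𝒜 ℬ).Le (fanTightnessGame (MU.topology 𝒜) (MU.topology ℬ) (MU.zero X)) := by
  classical
  let r : ℕ → ℝ := fun n => 1 / ((n : ℝ) + 1)
  have hr : ∀ n, 0 < r n := fun n => Nat.one_div_pos_of_nat
  let sub : ℕ → MU X → Set X := fun n Φ => {x | (Φ.1 x : Set ℝ) ⊆ Metric.ball 0 (r n)}
  have hsub : ∀ n Φ, IsOpen (sub n Φ) := fun n Φ => Φ.2.1 _ Metric.isOpen_ball
  -- If some `Φ ∈ S` is within `1/(n+1)` of `0` everywhere, its set `sub n Φ` is `univ`, not allowed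
  -- in a cover. Two then answers such a `Φ`, and the move in the cover game is a dummy.
  let full : ℕ → Set (MU X) → Prop := fun n S => ∃ Φ ∈ S, sub n Φ = univ
  have hcov : ∀ n, ∀ S ∈ clusterSets (MU.topology 𝒜) (MU.zero X), ¬ full n S →
      sub n '' S \ {∅} ∈ familyCovers 𝒜 := by
    intro n S hS hfull
    refine h𝒜.mem_familyCovers ?_ fun A hA => ?_
    · rintro _ ⟨⟨Φ, hΦ, rfl⟩, hne⟩
      exact ⟨hsub n Φ, nonempty_iff_ne_empty.mpr hne, fun h => hfull ⟨Φ, hΦ, h⟩⟩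
    · obtain ⟨Φ, hΦ, hA'⟩ := (MU.mem_clusterSets_zero h𝒜).mp hS A hA (r n) (hr n)
      exact ⟨sub n Φ, ⟨mem_image_of_mem _ hΦ, ((h𝒜.nonempty A hA).mono hA').ne_empty⟩, hA'⟩
  let φ : ℕ → ↥(clusterSets (MU.topology 𝒜) (MU.zero X)) → ↥(familyCovers 𝒜) := fun n S =>
    if h : full n S then ⟨_, compl_singletons_mem_familyCovers h𝒜 h𝒜X⟩ else ⟨_, hcov n S S.2 h⟩
  let good : ℕ → Set (MU X) → Set X → MU X → Prop := fun n S U Φ =>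
    Φ ∈ S ∧ (full n S → sub n Φ = univ) ∧ (¬ full n S → sub n Φ = U)
  have hgood : ∀ n S, ∀ U ∈ (φ n S : Set (Set X)), ∃ Φ, good n S U Φ := by
    intro n S U hU
    by_cases h : full n S
    · obtain ⟨Φ, hΦ, hΦ'⟩ := id h
      exact ⟨Φ, hΦ, fun _ => hΦ', fun h' => absurd h h'⟩
    · simp only [φ, h, dite_false] at hU
      obtain ⟨⟨Φ, hΦ, rfl⟩, -⟩ := hU
      exact ⟨Φ, hΦ, fun h' => absurd h' h, fun _ => rfl⟩
  have : Nonempty (MU X) := ⟨MU.zero X⟩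
  let ψ : ℕ → ↥(clusterSets (MU.topology 𝒜) (MU.zero X)) → Set X → MU X := fun n S U =>
    Classical.epsilon (good n S U)
  have hψ : ∀ n S, ∀ U ∈ (φ n S : Set (Set X)), good n S U (ψ n S U) :=
    fun n S U hU => Classical.epsilon_spec (hgood n S U hU)
  refine .of_translation (sUnion_familyCovers_nonempty h𝒜 h𝒜X) (sUnion_clusterSets_nonempty _ _)
    φ ψ (fun n S U hU => (hψ n S U hU).1) fun S U hU hgoal => ?_
  change range U ∈ familyCovers ℬ at hgoal
  refine (MU.mem_clusterSets_zero hℬ).mpr fun B hB ε hε => ?_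
  obtain ⟨N, hN⟩ := exists_nat_one_div_lt hε
  -- enlarging `B` by points outside the first members shows that these can be ignored
  have key : ∀ M, ∃ n ≥ M, B ⊆ U n := by
    intro M
    have hpt : ∀ n, ∃ x, x ∉ U n := fun n =>
      (ne_univ_iff_exists_notMem _).mp (properOpens_of_mem_familyCovers hgoal (mem_range_self n)).2.2
    choose p hp using hpt
    have hmem : ∀ M, B ∪ p '' {i | i < M} ∈ ℬ := by
      intro M
      induction M with
      | zero => simpa using hB
      | succ M ih =>
        have : B ∪ p '' {i | i < M + 1} = (B ∪ p '' {i | i < M}) ∪ {p M} := by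
          rw [union_assoc, ← image_singleton, ← image_union]
          congr 2
          ext i
          simp
          omega
        rw [this]
        exact hℬ.union _ ih _ (hℬ.singleton _)
    obtain ⟨_, ⟨n, rfl⟩, hn⟩ := hgoal.2.2.2.2 _ (hmem M)
    refine ⟨n, ?_, subset_union_left.trans hn⟩
    by_contra! hlt
    exact hp n (hn (Or.inr ⟨n, hlt, rfl⟩))
  obtain ⟨n, hnN, hBn⟩ := key N
  refine ⟨ψ n (S n) (U n), mem_range_self n, fun x hx => ?_⟩
  have hx' : x ∈ sub n (ψ n (S n) (U n)) := by
    have hg := hψ n (S n) (U n) (hU n)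
    by_cases h : full n (S n)
    · rw [hg.2.1 h]
      exact mem_univ x
    · rw [hg.2.2 h]
      exact hBn hx
  exact fun y hy =>
    Metric.ball_subset_ball ((Nat.one_div_le_one_div hnN).trans hN.le) (hx' hy)

/-- Selections from functions that are `1` off a member of a cover yield covers. -/
theorem le_coverGame (h𝒜 : IsClosedIdeal 𝒜) (h𝒜X : univ ∉ 𝒜) (hℬ : IsClosedIdeal ℬ)
    {β : Type*} {G : SelectionGame β} (hG : (⋃₀ G.moves).Nonempty) (j : β → MU X)
    (hmoves : ∀ 𝒰 ∈ familyCovers 𝒜, {b | ∃ U ∈ 𝒰, ∀ x ∉ U, (j b).1 x = {1}} ∈ G.moves)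
    (hgoal : ∀ S ∈ G.goal, j '' S ∈ clusterSets (MU.topology ℬ) (MU.zero X)) :
    G.Le (coverGame 𝒜 ℬ) := by
  refine .of_translation hG (sUnion_familyCovers_nonempty h𝒜 h𝒜X)
    (fun _ 𝒰 => ⟨_, hmoves 𝒰 𝒰.2⟩)
    (fun _ 𝒰 b => Classical.epsilon fun U => U ∈ (𝒰 : Set (Set X)) ∧ ∀ x ∉ U, (j b).1 x = {1})
    (fun _ 𝒰 b hb => (Classical.epsilon_spec hb).1) fun 𝒰 b hb hbgoal => ?_
  have hU := fun n => Classical.epsilon_spec (hb n)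
  refine hℬ.mem_familyCovers ?_ fun B hB => ?_
  · rintro _ ⟨n, rfl⟩
    exact properOpens_of_mem_familyCovers (𝒰 n).2 (hU n).1
  · obtain ⟨_, ⟨_, ⟨n, rfl⟩, rfl⟩, hn⟩ :=
      (MU.mem_clusterSets_zero hℬ).mp (hgoal _ hbgoal) B hB 1 one_pos
    refine ⟨_, mem_range_self n, fun x hx => ?_⟩
    by_contra hxU
    have := hn x hx
    rw [(hU n).2 x hxU] at this
    simp at this

theorem denseFanTightnessGame_le_coverGame (h𝒜 : IsClosedIdeal 𝒜) (h𝒜X : univ ∉ 𝒜)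
    (hℬ : IsClosedIdeal ℬ) (hN : FamilyNormal 𝒜) :
    (denseFanTightnessGame (MU.topology 𝒜) (MU.topology ℬ) (MU.zero X)).Le (coverGame 𝒜 ℬ) := by
  refine le_coverGame h𝒜 h𝒜X hℬ (sUnion_denseSets_nonempty _ (MU.zero X)) id (fun 𝒰 h𝒰 => ?_)
    fun S hS => by rwa [image_id]
  refine MU.dense_of_forall_eqOn h𝒜 fun Ψ A hA => ?_
  obtain ⟨U, hU, hAU⟩ := h𝒰.2.2.2.2 A hA
  obtain ⟨V, hV, hAV, hVU⟩ := hN A hA U (h𝒰.1 U hU) hAU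
  obtain ⟨Φ, hΦ, hΦV, hΦ1⟩ := Ψ.2.exists_eqOn_open hV 1
  exact ⟨⟨Φ, hΦ⟩, ⟨U, hU, fun x hx => hΦ1 x fun h => hx (hVU h)⟩, fun x hx => hΦV x (hAV hx)⟩

theorem cont_denseFanTightnessGame_le_coverGame (h𝒜 : IsClosedIdeal 𝒜) (h𝒜X : univ ∉ 𝒜)
    (hℬ : IsClosedIdeal ℬ) (hN : FunctionallyFamilyNormal 𝒜) :
    (denseFanTightnessGame (contTopology 𝒜) (contTopology ℬ) (0 : C(X, ℝ))).Le
      (coverGame 𝒜 ℬ) := by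
  refine le_coverGame h𝒜 h𝒜X hℬ (sUnion_denseSets_nonempty _ (0 : C(X, ℝ))) MU.ofCont
    (fun 𝒰 h𝒰 g => ?_) fun S hS => cont_mem_clusterSets_iff.mp hS
  rw [contTopology_eq_induced, @closure_induced _ _ (MU.topology 𝒜)]
  let _ := MU.topology 𝒜
  refine (mem_closure_iff_nhds_basis (MU.hasBasis_nhds h𝒜 _)).mpr ?_
  rintro ⟨A, E⟩ ⟨hA, hE⟩
  obtain ⟨U, hU, hAU⟩ := h𝒰.2.2.2.2 A hA
  obtain ⟨h, hh, h0, h1⟩ := hN A hA U (h𝒰.1 U hU) hAU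
  -- Interpolation between `g`, where `h = 0`, and `1`, where `h = 1`.
  refine ⟨_, ⟨g + ⟨h, hh⟩ * (1 - g), ⟨U, hU, fun x hx => ?_⟩, rfl⟩, fun x hx => ?_⟩
  · simp [MU.ofCont, h1 x hx]
  · have : (MU.ofCont (g + ⟨h, hh⟩ * (1 - g))).1 x = (MU.ofCont g).1 x := by
      simp [MU.ofCont, h0 x hx]
    rw [this]
    exact refl_mem_uniformity hE

end SelectionPrinciples

/-! ### Closing the cycles and dualizing -/

theorem corollary3p3 {X : Type*} [TopologicalSpace X] [Nonempty X] (𝒜 ℬ : Set (Set X))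
    (h𝒜 : IsClosedIdeal 𝒜) (hℬ : IsClosedIdeal ℬ)
    (h𝒜X : (Set.univ : Set X) ∉ 𝒜) (hℬX : (Set.univ : Set X) ∉ ℬ) :
    (FamilyNormal 𝒜 →
      ((coverGame 𝒜 ℬ).Equivalent
          (fanTightnessGame (MU.topology 𝒜) (MU.topology ℬ) (MU.zero X)) ∧
        (fanTightnessGame (MU.topology 𝒜) (MU.topology ℬ) (MU.zero X)).Equivalent
          (denseFanTightnessGame (MU.topology 𝒜) (MU.topology ℬ) (MU.zero X))) ∧
      ((pointOpenGame 𝒜 ℬ).Equivalent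
          (clusteringWGame (MU.topology 𝒜) (MU.topology ℬ) (MU.zero X)) ∧
        (clusteringWGame (MU.topology 𝒜) (MU.topology ℬ) (MU.zero X)).Equivalent
          (tkachukGame (MU.topology 𝒜) (MU.topology ℬ) (MU.zero X))) ∧
      (coverGame 𝒜 ℬ).Dual (pointOpenGame 𝒜 ℬ)) ∧
    (FunctionallyFamilyNormal 𝒜 →
      ((coverGame 𝒜 ℬ).Equivalent
          (fanTightnessGame (MU.topology 𝒜) (MU.topology ℬ) (MU.zero X)) ∧
        (fanTightnessGame (MU.topology 𝒜) (MU.topology ℬ) (MU.zero X)).Equivalent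
          (fanTightnessGame (contTopology 𝒜) (contTopology ℬ) (0 : C(X, ℝ))) ∧
        (fanTightnessGame (contTopology 𝒜) (contTopology ℬ) (0 : C(X, ℝ))).Equivalent
          (denseFanTightnessGame (MU.topology 𝒜) (MU.topology ℬ) (MU.zero X)) ∧
        (denseFanTightnessGame (MU.topology 𝒜) (MU.topology ℬ) (MU.zero X)).Equivalent
          (denseFanTightnessGame (contTopology 𝒜) (contTopology ℬ) (0 : C(X, ℝ)))) ∧
      ((pointOpenGame 𝒜 ℬ).Equivalent
          (clusteringWGame (MU.topology 𝒜) (MU.topology ℬ) (MU.zero X)) ∧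
        (clusteringWGame (MU.topology 𝒜) (MU.topology ℬ) (MU.zero X)).Equivalent
          (clusteringWGame (contTopology 𝒜) (contTopology ℬ) (0 : C(X, ℝ))) ∧
        (clusteringWGame (contTopology 𝒜) (contTopology ℬ) (0 : C(X, ℝ))).Equivalent
          (tkachukGame (MU.topology 𝒜) (MU.topology ℬ) (MU.zero X)) ∧
        (tkachukGame (MU.topology 𝒜) (MU.topology ℬ) (MU.zero X)).Equivalent
          (tkachukGame (contTopology 𝒜) (contTopology ℬ) (0 : C(X, ℝ))))) := by
  have fan_le_dense := fanTightnessGame_le_dense (MU.topology 𝒜) (MU.topology ℬ) (MU.zero X)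
  have cover_le_fan := coverGame_le_fanTightnessGame h𝒜 h𝒜X hℬ
  have cover_dual := coverGame_dual h𝒜 h𝒜X ℬ
  obtain ⟨U, hU, -⟩ := MU.properNhds_nonempty h𝒜
  have fan_dual := fanTightnessGame_dual _ (MU.topology ℬ) _ ⟨U, hU⟩
  have dense_dual := denseFanTightnessGame_dual _ (MU.topology ℬ) (MU.zero X) ⟨U, hU.1⟩
  obtain ⟨V, hV⟩ := cont_properNhds_nonempty h𝒜
  have fan_dual' := fanTightnessGame_dual _ (contTopology ℬ) _ ⟨V, hV⟩
  have dense_dual' := denseFanTightnessGame_dual _ (contTopology ℬ) (0 : C(X, ℝ)) ⟨V, hV.1⟩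
  refine ⟨fun hN => ?_, fun hN => ?_⟩
  · have dense_le_cover := denseFanTightnessGame_le_coverGame h𝒜 h𝒜X hℬ hN
    have e₁ := cover_le_fan.equivalent (fan_le_dense.trans dense_le_cover)
    have e₂ := fan_le_dense.equivalent (dense_le_cover.trans cover_le_fan)
    exact ⟨⟨e₁, e₂⟩, ⟨e₁.of_dual cover_dual fan_dual, e₂.of_dual fan_dual dense_dual⟩, cover_dual⟩
  · have dense_le_cover := denseFanTightnessGame_le_coverGame h𝒜 h𝒜X hℬ hN.familyNormal
    have dense_le_cover' := cont_denseFanTightnessGame_le_coverGame h𝒜 h𝒜X hℬ hN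
    have fan_le_fan' := fanTightnessGame_le_cont (𝒜 := 𝒜) (ℬ := ℬ)
    have fan_le_dense' := fanTightnessGame_le_dense (contTopology 𝒜) (contTopology ℬ) (0 : C(X, ℝ))
    have fan'_le_cover := fan_le_dense'.trans dense_le_cover'
    have cover_le_dense := cover_le_fan.trans fan_le_dense
    have cover_le_fan' := cover_le_fan.trans fan_le_fan'
    have e₁ := cover_le_fan.equivalent (fan_le_dense.trans dense_le_cover)
    have e₂ := fan_le_fan'.equivalent (fan'_le_cover.trans cover_le_fan)
    have e₃ := (fan'_le_cover.trans cover_le_dense).equivalent (dense_le_cover.trans cover_le_fan')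
    have e₄ := (dense_le_cover.trans (cover_le_fan'.trans fan_le_dense')).equivalent
      (dense_le_cover'.trans cover_le_dense)
    exact ⟨⟨e₁, e₂, e₃, e₄⟩, e₁.of_dual cover_dual fan_dual, e₂.of_dual fan_dual fan_dual',
      e₃.of_dual fan_dual' dense_dual, e₄.of_dual dense_dual dense_dual'⟩
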